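/- Let $m \geq 3$ and $n \geq 2$ be integers and let $K$ be a field containing a primitive $m$-th root of unity $q$. Let $U_n(K)=\{\omega\in K : \omega^n=1\}$, a cyclic group of order $\nu(n)=|U_n(K)|$. For $\omega\in U_n(K)$ let $T^{\omega}_{nm^2}=T^{\omega}_{nm^2}(q)$ be the Hopf algebra over $K$ generated as an algebra by $g,h,x$ subject to the relations $$g^n=h^m=1,\quad x^m=0,\quad xh=q\,hx,\quad hg=gh,\quad gx=\omega\,xg,$$ with coalgebra structure and antipode given by $$\Delta(g)=g\otimes g,\quad \Delta(h)=h\otimes h,\quad \Delta(x)=x\otimes h+1\otimes x,\quad \varepsilon(g)=\varepsilon(h)=1,\quad \varepsilon(x)=0,$$ $$S(g)=g^{n-1},\quad S(h)=h^{m-1},\quad S(x)=-xh^{m-1}.$$ Let $\xi$ be a generator of $U_n(K)$ and, for $t\in\{0,1,\dots,\nu(n)-1\}$, let $$S^t_{m,n}(q)=\{(\bar l,\hat s)\in \mathbb Z_m\times U(\mathbb Z_n) : \xi^{t(s-1)}=q^{l}\},$$ which is a group (with well-defined product) under $(\bar l,\hat s)(\bar l',\hat s')=(\overline{l+sl'},\widehat{ss'})$.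 Then for every $t\in\{0,1,\dots,\nu(n)-1\}$ there is an isomorphism of groups $$\mathrm{Aut}_{\rm Hopf}\big(T^{\xi^t}_{nm^2}\big)\;\cong\; K^*\times S^t_{m,n}(q),$$ where $\mathrm{Aut}_{\rm Hopf}$ denotes the group of Hopf algebra automorphisms under composition. -/

import Mathlib

open scoped TensorProduct

universe u

/-! ### Hopf algebra automorphisms -/

/-- The Hopf algebra automorphisms of `A`: bijective maps which are morphisms of algebras and of
coalgebras.  (Such a map automatically commutes with the antipode, see `HopfAut.map_antipode`.) -/
abbrev HopfAut (K A : Type*) [CommSemiring K] [Semiring A] [HopfAlgebra K A] : Type _ :=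
  A ≃ₐc[K] A

namespace HopfAut

variable {K A : Type*} [CommSemiring K] [Semiring A] [HopfAlgebra K A]

/-- Hopf algebra automorphisms form a group under composition. -/
instance instGroup : Group (HopfAut K A) where
  mul f g := BialgEquiv.trans g f
  one := BialgEquiv.refl K A
  inv f := BialgEquiv.symm f
  mul_assoc _ _ _ := rfl
  one_mul _ := rfl
  mul_one _ := rfl
  inv_mul_cancel f := BialgEquiv.ext fun x => BialgEquiv.symm_apply_apply f x

theorem mul_apply (f g : HopfAut K A) (x : A) : (f * g) x = f (g x) := rfl

theorem map_antipode (f : HopfAut K A) (x : A) :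
    f (HopfAlgebra.antipode K x) = HopfAlgebra.antipode K (f x) := by
  have key : WithConv.toConv ((f : A →ₗ[K] A) ∘ₗ HopfAlgebra.antipode K) =
      WithConv.toConv (HopfAlgebra.antipode K ∘ₗ (f : A →ₗ[K] A)) := by
    apply left_inv_eq_right_inv (a := WithConv.toConv (f : A →ₗ[K] A))
    · apply WithConv.ofConv_injective
      have h := LinearMap.algHom_comp_convMul_distrib
        (f.toBialgHom : A →ₐ[K] A) (WithConv.toConv (HopfAlgebra.antipode K))
        (WithConv.toConv LinearMap.id)
      rw [LinearMap.antipode_mul_id, LinearMap.algHom_comp_convOne] at h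
      exact h.symm
    · apply WithConv.ofConv_injective
      have h := LinearMap.convMul_comp_coalgHom_distrib
        (WithConv.toConv LinearMap.id) (WithConv.toConv (HopfAlgebra.antipode K))
        f.toBialgHom.toCoalgHom
      rw [LinearMap.id_mul_antipode, LinearMap.convOne_comp_coalgHom] at h
      exact h.symm
  exact LinearMap.congr_fun (WithConv.toConv_injective key) x

end HopfAut

/-! ### Auxiliary facts -/

namespace TaftAux

/-- Gaussian binomial coefficients evaluated at `q`. -/
def gaussBinom {K : Type*} [Field K] (q : K) : ℕ → ℕ → K
  | 0, 0 => 1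
  | 0, _ + 1 => 0
  | _ + 1, 0 => 1
  | n + 1, k + 1 => gaussBinom q n k + q ^ (k + 1) * gaussBinom q n (k + 1)

section

variable {K : Type*} [Field K] (q : K)

theorem gaussBinom_zero (n : ℕ) : gaussBinom q n 0 = 1 := by
  cases n <;> simp [gaussBinom]

theorem gaussBinom_of_lt : ∀ (n k : ℕ), n < k → gaussBinom q n k = 0
  | 0, 0, h => by omega
  | 0, _ + 1, _ => rfl
  | _ + 1, 0, h => by omega
  | n + 1, k + 1, h => by
      simp [gaussBinom, gaussBinom_of_lt n k (by omega), gaussBinom_of_lt n (k + 1) (by omega)]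

theorem gaussBinom_self : ∀ n : ℕ, gaussBinom q n n = 1
  | 0 => rfl
  | n + 1 => by simp [gaussBinom, gaussBinom_self n, gaussBinom_of_lt q n (n + 1) (by omega)]

theorem gaussBinom_succ_mul (n : ℕ) : ∀ k : ℕ,
    (q ^ (k + 1) - 1) * gaussBinom q (n + 1) (k + 1) = (q ^ (n + 1) - 1) * gaussBinom q n k := by
  induction n with
  | zero =>
    intro k
    cases k <;> simp [gaussBinom]
  | succ n ih =>
    intro k
    cases k with
    | zero =>
      have h := ih 0
      rw [gaussBinom_zero] at h ⊢
      rw [gaussBinom, gaussBinom_zero]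
      linear_combination q * h
    | succ j =>
      have h1 := ih j
      have h2 := ih (j + 1)
      rw [gaussBinom]
      have h3 : gaussBinom q (n + 1) (j + 1) =
        gaussBinom q n j + q ^ (j + 1) * gaussBinom q n (j + 1) := by rw [gaussBinom]
      linear_combination q ^ (j + 2) * h2 + q * h1 + (q - q ^ (n + 2)) * h3

theorem gaussBinom_eq_zero {m k : ℕ} (hq : IsPrimitiveRoot q m) (hk : 0 < k) (hkm : k < m) :
    gaussBinom q m k = 0 := by
  obtain ⟨k, rfl⟩ := Nat.exists_eq_succ_of_ne_zero hk.ne'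
  obtain ⟨m, rfl⟩ := Nat.exists_eq_succ_of_ne_zero (by omega : m ≠ 0)
  have h := gaussBinom_succ_mul q m k
  rw [show q ^ (m + 1) = 1 from hq.pow_eq_one, sub_self, zero_mul] at h
  refine (mul_eq_zero.1 h).resolve_left (sub_ne_zero.2 ?_)
  exact hq.pow_ne_one_of_pos_of_lt (by omega) hkm

variable {A : Type*} [Ring A] [Algebra K A] {q} {a b : A}

theorem mul_pow_of_qcomm (h : b * a = q • (a * b)) (k : ℕ) : b * a ^ k = q ^ k • (a ^ k * b) := by
  induction k with
  | zero => simp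
  | succ k ih =>
    rw [pow_succ, ← mul_assoc, ih, smul_mul_assoc, mul_assoc, h, mul_smul_comm, smul_smul,
      ← mul_assoc, pow_succ]

theorem pow_mul_of_qcomm (h : b * a = q • (a * b)) (k : ℕ) : b ^ k * a = q ^ k • (a * b ^ k) := by
  induction k with
  | zero => simp
  | succ k ih =>
    rw [pow_succ', mul_assoc, ih, mul_smul_comm, ← mul_assoc, h, smul_mul_assoc, smul_smul,
      mul_assoc, pow_succ]

/-- The `q`-binomial theorem. -/
theorem add_pow_of_qcomm (h : b * a = q • (a * b)) (n : ℕ) :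
    (a + b) ^ n = ∑ k ∈ Finset.range (n + 1), gaussBinom q n k • (a ^ k * b ^ (n - k)) := by
  induction n with
  | zero => simp [gaussBinom]
  | succ n ih =>
    rw [pow_succ', ih, add_mul, Finset.mul_sum, Finset.mul_sum,
      Finset.sum_range_succ' _ (n + 1)]
    have e1 : ∀ k ∈ Finset.range (n + 1), gaussBinom q (n + 1) (k + 1) •
        (a ^ (k + 1) * b ^ (n + 1 - (k + 1))) =
        a * (gaussBinom q n k • (a ^ k * b ^ (n - k))) +
        (q ^ (k + 1) * gaussBinom q n (k + 1)) • (a ^ (k + 1) * b ^ (n - k)) := by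
      intro k _
      rw [gaussBinom, add_smul, mul_smul_comm, ← mul_assoc, ← pow_succ', Nat.add_sub_add_right]
    rw [Finset.sum_congr rfl e1, Finset.sum_add_distrib, add_assoc]
    congr 1
    have e2 : ∀ k ∈ Finset.range (n + 1), b * (gaussBinom q n k • (a ^ k * b ^ (n - k))) =
        (q ^ k * gaussBinom q n k) • (a ^ k * b ^ (n + 1 - k)) := by
      intro k hk
      have : n + 1 - k = (n - k) + 1 := by
        have := Finset.mem_range.1 hk
        omega
      rw [mul_smul_comm, ← mul_assoc, mul_pow_of_qcomm h, this, pow_succ', smul_mul_assoc,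
        smul_smul, mul_assoc, mul_comm]
    rw [Finset.sum_congr rfl e2, Finset.sum_range_succ', Finset.sum_range_succ _ n,
      gaussBinom_of_lt q n (n + 1) (by omega)]
    simp [gaussBinom_zero]

theorem add_pow_primitive {m : ℕ} [NeZero m] (hq : IsPrimitiveRoot q m)
    (h : b * a = q • (a * b)) (ha : a ^ m = 0) (hb : b ^ m = 0) : (a + b) ^ m = 0 := by
  rw [add_pow_of_qcomm h]
  refine Finset.sum_eq_zero fun k hk => ?_
  rcases Nat.eq_zero_or_pos k with rfl | hk0
  · simp [hb]
  · rcases (Nat.lt_succ_iff.1 (Finset.mem_range.1 hk)).lt_or_eq with hlt | rfl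
    · rw [gaussBinom_eq_zero q hq hk0 hlt, zero_smul]
    · simp [ha]

end

/-- An anti-endomorphism of a bialgebra satisfying the antipode axioms on algebra generators
is an antipode. -/
noncomputable abbrev hopfOfGenerators {K A : Type*} [CommRing K] [Ring A] [Bialgebra K A]
    (S : A →ₐ[K] Aᵐᵒᵖ) (s : Set A) (hs : Algebra.adjoin K s = ⊤)
    (h₁ : ∀ a ∈ s, LinearMap.mul' K A
      ((((MulOpposite.opLinearEquiv K).symm.toLinearMap ∘ₗ S.toLinearMap).rTensor A)
        (Coalgebra.comul a)) = algebraMap K A (Coalgebra.counit a))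
    (h₂ : ∀ a ∈ s, LinearMap.mul' K A
      ((((MulOpposite.opLinearEquiv K).symm.toLinearMap ∘ₗ S.toLinearMap).lTensor A)
        (Coalgebra.comul a)) = algebraMap K A (Coalgebra.counit a)) :
    HopfAlgebra K A where
  antipode := (MulOpposite.opLinearEquiv K).symm.toLinearMap ∘ₗ S.toLinearMap
  mul_antipode_rTensor_comul := by
    set T : A →ₗ[K] A := (MulOpposite.opLinearEquiv K).symm.toLinearMap ∘ₗ S.toLinearMap with hT
    have hTmul : ∀ a b, T (a * b) = T b * T a := fun a b => by simp [hT]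
    have hT1 : T 1 = 1 := by simp [hT]
    have key : ∀ (X Y : A ⊗[K] A) (c : K), LinearMap.mul' K A (T.rTensor A X) = algebraMap K A c →
        LinearMap.mul' K A (T.rTensor A (X * Y)) =
          algebraMap K A c * LinearMap.mul' K A (T.rTensor A Y) := by
      intro X Y c hX
      have aux : ∀ (b₁ b₂ : A), LinearMap.mul' K A (T.rTensor A (X * (b₁ ⊗ₜ[K] b₂))) =
          T b₁ * LinearMap.mul' K A (T.rTensor A X) * b₂ := by
        intro b₁ b₂
        clear hX
        induction X with
        | zero => simp
        | tmul x y => simp [hTmul, mul_assoc]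
        | add x y hx hy => simp only [add_mul, map_add, hx, hy, mul_add]
      induction Y with
      | zero => simp
      | tmul b₁ b₂ =>
        rw [aux, hX, ← Algebra.commutes c (T b₁)]
        simp [mul_assoc]
      | add x y hx hy => simp only [mul_add, map_add, hx, hy]
    refine LinearMap.ext fun a => ?_
    have ha : a ∈ Algebra.adjoin K s := by rw [hs]; trivial
    change LinearMap.mul' K A (T.rTensor A (Coalgebra.comul a)) = algebraMap K A (Coalgebra.counit a)
    induction ha using Algebra.adjoin_induction with
    | mem x hx => exact h₁ x hx
    | algebraMap r =>
      simp [hT1, Algebra.TensorProduct.one_def, Algebra.algebraMap_eq_smul_one]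
    | add x y _ _ hx hy => simp only [map_add, hx, hy]
    | mul x y _ _ hx hy => rw [Bialgebra.comul_mul, key _ _ _ hx, hy, Bialgebra.counit_mul, map_mul]
  mul_antipode_lTensor_comul := by
    set T : A →ₗ[K] A := (MulOpposite.opLinearEquiv K).symm.toLinearMap ∘ₗ S.toLinearMap with hT
    have hTmul : ∀ a b, T (a * b) = T b * T a := fun a b => by simp [hT]
    have hT1 : T 1 = 1 := by simp [hT]
    have key : ∀ (X Y : A ⊗[K] A) (c : K), LinearMap.mul' K A (T.lTensor A Y) = algebraMap K A c →
        LinearMap.mul' K A (T.lTensor A (X * Y)) =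
          LinearMap.mul' K A (T.lTensor A X) * algebraMap K A c := by
      intro X Y c hY
      have aux : ∀ (b₁ b₂ : A), LinearMap.mul' K A (T.lTensor A ((b₁ ⊗ₜ[K] b₂) * Y)) =
          b₁ * LinearMap.mul' K A (T.lTensor A Y) * T b₂ := by
        intro b₁ b₂
        clear hY
        induction Y with
        | zero => simp
        | tmul x y => simp [hTmul, mul_assoc]
        | add x y hx hy => simp only [mul_add, map_add, hx, hy, add_mul]
      induction X with
      | zero => simp
      | tmul b₁ b₂ =>
        rw [aux, hY, mul_assoc, Algebra.commutes c (T b₂)]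
        simp [mul_assoc]
      | add x y hx hy => simp only [add_mul, map_add, hx, hy]
    refine LinearMap.ext fun a => ?_
    have ha : a ∈ Algebra.adjoin K s := by rw [hs]; trivial
    change LinearMap.mul' K A (T.lTensor A (Coalgebra.comul a)) = algebraMap K A (Coalgebra.counit a)
    induction ha using Algebra.adjoin_induction with
    | mem x hx => exact h₂ x hx
    | algebraMap r =>
      simp [hT1, Algebra.TensorProduct.one_def, Algebra.algebraMap_eq_smul_one]
    | add x y _ _ hx hy => simp only [map_add, hx, hy]
    | mul x y _ _ hx hy => rw [Bialgebra.comul_mul, key _ _ _ hy, hx, Bialgebra.counit_mul, map_mul]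

end TaftAux

/-! ### The Hopf algebras `T_{nm²}^ω(q)` -/

/-- The three algebra generators. -/
inductive QTaftGen : Type
  | g | h | x

namespace QTaft

open FreeAlgebra in
/-- The defining relations
`gⁿ = hᵐ = 1`, `xᵐ = 0`, `x h = q h x`, `h g = g h`, `g x = ω x g`. -/
inductive Rel {K : Type u} [Field K] (m n : ℕ) (q ω : K) :
    FreeAlgebra K QTaftGen → FreeAlgebra K QTaftGen → Prop
  | g_pow : Rel m n q ω (ι K .g ^ n) 1
  | h_pow : Rel m n q ω (ι K .h ^ m) 1
  | x_pow : Rel m n q ω (ι K .x ^ m) 0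
  | x_mul_h : Rel m n q ω (ι K .x * ι K .h) (q • (ι K .h * ι K .x))
  | h_mul_g : Rel m n q ω (ι K .h * ι K .g) (ι K .g * ι K .h)
  | g_mul_x : Rel m n q ω (ι K .g * ι K .x) (ω • (ι K .x * ι K .g))

end QTaft

/-- The algebra `T_{nm²}^ω(q)` over `K`, where `q` is a primitive `m`-th root of unity and `ω` is
an `n`-th root of unity, generated by `g, h, x` subject to the relations `QTaft.Rel`. -/
def QTaft {K : Type u} [Field K] {m n : ℕ} {q : K} (_hq : IsPrimitiveRoot q m)
    (ω : rootsOfUnity n K) : Type u :=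
  RingQuot (QTaft.Rel m n q ((ω : Kˣ) : K))

namespace QTaft

variable {K : Type u} [Field K] {m n : ℕ} {q : K} (hq : IsPrimitiveRoot q m)
  (ω : rootsOfUnity n K)

noncomputable instance instRing : Ring (QTaft hq ω) :=
  inferInstanceAs (Ring (RingQuot (QTaft.Rel m n q ((ω : Kˣ) : K))))

noncomputable instance instAlgebra : Algebra K (QTaft hq ω) :=
  inferInstanceAs (Algebra K (RingQuot (QTaft.Rel m n q ((ω : Kˣ) : K))))

/-- The image of a generator in `T_{nm²}^ω(q)`. -/
noncomputable def gen (i : QTaftGen) : QTaft hq ω :=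
  RingQuot.mkAlgHom K (QTaft.Rel m n q ((ω : Kˣ) : K)) (FreeAlgebra.ι K i)

/-- The generator `g`. -/
noncomputable abbrev g : QTaft hq ω := gen hq ω .g

/-- The generator `h`. -/
noncomputable abbrev h : QTaft hq ω := gen hq ω .h

/-- The generator `x`. -/
noncomputable abbrev x : QTaft hq ω := gen hq ω .x

/-- The projection from the free algebra. -/
noncomputable def mk : FreeAlgebra K QTaftGen →ₐ[K] QTaft hq ω :=
  RingQuot.mkAlgHom K (QTaft.Rel m n q ((ω : Kˣ) : K))

theorem mk_surjective : Function.Surjective (mk hq ω) := RingQuot.mkAlgHom_surjective _ _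

@[simp] theorem mk_ι (i : QTaftGen) : mk hq ω (FreeAlgebra.ι K i) = gen hq ω i := rfl

theorem mk_rel {a b : FreeAlgebra K QTaftGen} (r : Rel m n q ((ω : Kˣ) : K) a b) :
    mk hq ω a = mk hq ω b := RingQuot.mkAlgHom_rel K r

theorem g_pow : g hq ω ^ n = 1 := by simpa using mk_rel hq ω .g_pow
theorem h_pow : h hq ω ^ m = 1 := by simpa using mk_rel hq ω .h_pow
theorem x_pow : x hq ω ^ m = 0 := by simpa using mk_rel hq ω .x_pow
theorem x_mul_h : x hq ω * h hq ω = q • (h hq ω * x hq ω) := by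
  simpa using mk_rel hq ω .x_mul_h
theorem h_mul_g : h hq ω * g hq ω = g hq ω * h hq ω := by simpa using mk_rel hq ω .h_mul_g
theorem g_mul_x : g hq ω * x hq ω = ((ω : Kˣ) : K) • (x hq ω * g hq ω) := by
  simpa using mk_rel hq ω .g_mul_x

/-- The family `f` satisfies the defining relations. -/
structure Sat (n : ℕ) (ω : rootsOfUnity n K) (m : ℕ) (q : K) {B : Type*} [Semiring B] [Algebra K B]
    (f : QTaftGen → B) : Prop where
  g_pow : f .g ^ n = 1
  h_pow : f .h ^ m = 1
  x_pow : f .x ^ m = 0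
  x_mul_h : f .x * f .h = q • (f .h * f .x)
  h_mul_g : f .h * f .g = f .g * f .h
  g_mul_x : f .g * f .x = ((ω : Kˣ) : K) • (f .x * f .g)

/-- The universal property of the presentation. -/
noncomputable def lift {B : Type*} [Semiring B] [Algebra K B] {f : QTaftGen → B}
    (hf : Sat n ω m q f) : QTaft hq ω →ₐ[K] B :=
  RingQuot.liftAlgHom K ⟨FreeAlgebra.lift K f, by
    intro a b r
    obtain ⟨h1, h2, h3, h4, h5, h6⟩ := hf
    cases r <;> simpa⟩

@[simp] theorem lift_gen {B : Type*} [Semiring B] [Algebra K B] {f : QTaftGen → B}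
    (hf : Sat n ω m q f) (i : QTaftGen) : lift hq ω hf (gen hq ω i) = f i := by
  simp only [lift, gen]
  erw [RingQuot.liftAlgHom_mkAlgHom_apply]
  simp

variable {hq ω} in
theorem algHom_ext {B : Type*} [Semiring B] [Algebra K B] {φ ψ : QTaft hq ω →ₐ[K] B}
    (e : ∀ i, φ (gen hq ω i) = ψ (gen hq ω i)) : φ = ψ := by
  have : φ.comp (mk hq ω) = ψ.comp (mk hq ω) := FreeAlgebra.hom_ext (funext fun i => e i)
  refine AlgHom.ext fun a => ?_
  obtain ⟨a, rfl⟩ := mk_surjective hq ω a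
  exact DFunLike.congr_fun this a

theorem adjoin_gen : Algebra.adjoin K (Set.range (gen hq ω)) = ⊤ := by
  have e : Set.range (gen hq ω) = mk hq ω '' Set.range (FreeAlgebra.ι K) := by
    rw [← Set.range_comp]; rfl
  rw [e, ← AlgHom.map_adjoin, FreeAlgebra.adjoin_range_ι, Algebra.map_top,
    AlgHom.range_eq_top]
  exact mk_surjective hq ω

theorem mul_h_pow_pow (p k : ℕ) : ∃ c : K,
    (x hq ω * h hq ω ^ p) ^ k = c • (h hq ω ^ (p * k) * x hq ω ^ k) := by
  induction k with
  | zero => exact ⟨1, by simp⟩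
  | succ k ih =>
    obtain ⟨c, hc⟩ := ih
    have e1 := TaftAux.mul_pow_of_qcomm (x_mul_h hq ω) p
    have e2 : x hq ω ^ k * h hq ω ^ p = (q ^ p) ^ k • (h hq ω ^ p * x hq ω ^ k) :=
      TaftAux.pow_mul_of_qcomm e1 k
    refine ⟨c * (q ^ p * (q ^ p) ^ k), ?_⟩
    rw [pow_succ, hc, e1, smul_mul_assoc, mul_smul_comm, smul_smul, mul_assoc,
      ← mul_assoc (x hq ω ^ k), e2, smul_mul_assoc, mul_smul_comm, smul_smul, mul_assoc (h hq ω ^ p),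
      ← pow_succ, ← mul_assoc, ← pow_add, mul_add_one, mul_assoc c]

/-- `Δ(g) = g ⊗ g`, `Δ(h) = h ⊗ h`, `Δ(x) = x ⊗ h + 1 ⊗ x`. -/
noncomputable def comulGen : QTaftGen → QTaft hq ω ⊗[K] QTaft hq ω
  | .g => g hq ω ⊗ₜ g hq ω
  | .h => h hq ω ⊗ₜ h hq ω
  | .x => x hq ω ⊗ₜ h hq ω + 1 ⊗ₜ x hq ω

/-- `ε(g) = ε(h) = 1`, `ε(x) = 0`. -/
def counitGen : QTaftGen → K
  | .g => 1
  | .h => 1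
  | .x => 0

/-- `S(g) = g^{n-1}`, `S(h) = h^{m-1}`, `S(x) = -x h^{m-1}`. -/
noncomputable def antipodeGen (n : ℕ) (ω : rootsOfUnity n K) : QTaftGen → QTaft hq ω
  | .g => g hq ω ^ (n - 1)
  | .h => h hq ω ^ (m - 1)
  | .x => -(x hq ω * h hq ω ^ (m - 1))

variable [NeZero m]

theorem comulHom_sat : Sat n ω m q (comulGen hq ω) where
  g_pow := by simp [comulGen, Algebra.TensorProduct.tmul_pow, g_pow, Algebra.TensorProduct.one_def]
  h_pow := by simp [comulGen, Algebra.TensorProduct.tmul_pow, h_pow, Algebra.TensorProduct.one_def]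
  x_pow := by
      apply TaftAux.add_pow_primitive hq
      · simp [x_mul_h]
      · simp [Algebra.TensorProduct.tmul_pow, x_pow]
      · simp [Algebra.TensorProduct.tmul_pow, x_pow]
  x_mul_h := by simp [comulGen, add_mul, mul_add, x_mul_h, TensorProduct.smul_tmul']
  h_mul_g := by simp [comulGen, h_mul_g]
  g_mul_x := by simp [comulGen, add_mul, mul_add, g_mul_x, h_mul_g, TensorProduct.smul_tmul']

/-- The comultiplication. -/
noncomputable def comulHom : QTaft hq ω →ₐ[K] QTaft hq ω ⊗[K] QTaft hq ω :=
  lift hq ω (comulHom_sat hq ω)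

@[simp] theorem comulHom_gen (i : QTaftGen) :
    comulHom hq ω (gen hq ω i) = comulGen hq ω i := by
  unfold comulHom
  exact lift_gen hq ω _ i

theorem counitHom_sat (_hq : IsPrimitiveRoot q m) (ω : rootsOfUnity n K) : Sat n ω m q (counitGen (K := K)) where
  g_pow := by simp [counitGen]
  h_pow := by simp [counitGen]
  x_pow := by simp [counitGen, NeZero.ne m]
  x_mul_h := by simp [counitGen]
  h_mul_g := by simp [counitGen]
  g_mul_x := by simp [counitGen]

/-- The counit. -/
noncomputable def counitHom : QTaft hq ω →ₐ[K] K :=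
  lift hq ω (counitHom_sat hq ω)

@[simp] theorem counitHom_gen (i : QTaftGen) :
    counitHom hq ω (gen hq ω i) = counitGen (K := K) i := by
  unfold counitHom
  exact lift_gen hq ω _ i

noncomputable instance instBialgebra : Bialgebra K (QTaft hq ω) :=
  Bialgebra.ofAlgHom (comulHom hq ω) (counitHom hq ω)
    (by
      apply algHom_ext
      rintro (_ | _ | _) <;>
        simp [comulGen, TensorProduct.add_tmul, TensorProduct.tmul_add, add_assoc,
          Algebra.TensorProduct.one_def])
    (by
      apply algHom_ext
      rintro (_ | _ | _) <;> simp [comulGen, counitGen])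
    (by
      apply algHom_ext
      rintro (_ | _ | _) <;> simp [comulGen, counitGen])

@[simp] theorem comul_gen (i : QTaftGen) :
    Coalgebra.comul (R := K) (gen hq ω i) = comulGen hq ω i :=
  comulHom_gen hq ω i

@[simp] theorem counit_gen (i : QTaftGen) :
    Coalgebra.counit (R := K) (gen hq ω i) = counitGen i :=
  counitHom_gen hq ω i

variable [NeZero n]

theorem antipodeHom_sat : Sat n ω m q (fun i => MulOpposite.op (antipodeGen hq n ω i)) where
  g_pow := by
      simp only [antipodeGen]
      rw [← MulOpposite.op_pow, ← pow_mul, mul_comm, pow_mul, g_pow, one_pow, MulOpposite.op_one]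
  h_pow := by
      simp only [antipodeGen]
      rw [← MulOpposite.op_pow, ← pow_mul, mul_comm, pow_mul, h_pow, one_pow, MulOpposite.op_one]
  x_pow := by
      obtain ⟨c, hc⟩ := mul_h_pow_pow hq ω (m - 1) m
      simp only [antipodeGen]
      rw [← MulOpposite.op_pow, neg_pow, hc, x_pow]
      simp
  x_mul_h := by
      simp only [antipodeGen]
      rw [← MulOpposite.op_mul, ← MulOpposite.op_mul, ← MulOpposite.op_smul]
      congr 1
      have e := TaftAux.mul_pow_of_qcomm (x_mul_h hq ω) (m - 1)
      rw [mul_neg, neg_mul, smul_neg, neg_inj, ← mul_assoc, e, smul_mul_assoc, smul_smul,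
        mul_pow_sub_one (NeZero.ne m), hq.pow_eq_one, one_smul]
  h_mul_g := by
      simp only [antipodeGen]
      rw [← MulOpposite.op_mul, ← MulOpposite.op_mul]
      congr 1
      exact (Commute.pow_pow (h_mul_g hq ω).symm _ _).eq
  g_mul_x := by
      simp only [antipodeGen]
      rw [← MulOpposite.op_mul, ← MulOpposite.op_mul, ← MulOpposite.op_smul]
      congr 1
      have e := TaftAux.pow_mul_of_qcomm (g_mul_x hq ω) (n - 1)
      have c : h hq ω ^ (m - 1) * g hq ω ^ (n - 1) = g hq ω ^ (n - 1) * h hq ω ^ (m - 1) :=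
        (Commute.pow_pow (h_mul_g hq ω) _ _).eq
      have o : ((ω : Kˣ) : K) ^ n = 1 := by
        have := (mem_rootsOfUnity' n (ω : Kˣ)).1 ω.2
        exact this
      rw [mul_neg, neg_mul, smul_neg, neg_inj, ← mul_assoc, e, smul_mul_assoc, smul_smul,
        mul_pow_sub_one (NeZero.ne n), o, one_smul, mul_assoc, mul_assoc, c]

/-- The antipode, as an algebra morphism to the opposite algebra. -/
noncomputable def antipodeHom : QTaft hq ω →ₐ[K] (QTaft hq ω)ᵐᵒᵖ :=
  lift hq ω (antipodeHom_sat hq ω)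

@[simp] theorem antipodeHom_gen (i : QTaftGen) :
    antipodeHom hq ω (gen hq ω i) = MulOpposite.op (antipodeGen hq n ω i) := by
  unfold antipodeHom
  exact lift_gen hq ω _ i

noncomputable instance instHopfAlgebra : HopfAlgebra K (QTaft hq ω) :=
  TaftAux.hopfOfGenerators (antipodeHom hq ω) (Set.range (gen hq ω)) (adjoin_gen hq ω)
    (by
      rintro _ ⟨_ | _ | _, rfl⟩
      · simp [comulGen, counitGen, antipodeGen, pow_sub_one_mul (NeZero.ne n), g_pow]
      · simp [comulGen, counitGen, antipodeGen, pow_sub_one_mul (NeZero.ne m), h_pow]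
      · simp [comulGen, counitGen, antipodeGen, mul_assoc, pow_sub_one_mul (NeZero.ne m), h_pow])
    (by
      rintro _ ⟨_ | _ | _, rfl⟩
      · simp [comulGen, counitGen, antipodeGen, mul_pow_sub_one (NeZero.ne n), g_pow]
      · simp [comulGen, counitGen, antipodeGen, mul_pow_sub_one (NeZero.ne m), h_pow]
      · simp [comulGen, counitGen, antipodeGen])

@[simp] theorem antipode_gen (i : QTaftGen) :
    HopfAlgebra.antipode K (gen hq ω i) = antipodeGen hq n ω i := by
  change MulOpposite.unop (antipodeHom hq ω (gen hq ω i)) = _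
  simp

end QTaft

/-! ### The groups `S^t_{m,n}(q)` -/

/-- The set of pairs `(l, s) ∈ ℤ_m × U(ℤ_n)` with `ξ^{t(s-1)} = q^l`; the condition does not depend
on the chosen representatives since `ξⁿ = 1` and `q^m = 1` (see `TaftS.cond_iff`). -/
@[ext] structure TaftS {K : Type u} [Field K] {m n : ℕ} {q : K} (_hq : IsPrimitiveRoot q m)
    (ξ : rootsOfUnity n K) (t : ℕ) : Type where
  l : ZMod m
  s : (ZMod n)ˣ
  cond : (((ξ ^ ((t : ℤ) * (((s : ZMod n).val : ℤ) - 1)) : rootsOfUnity n K) : Kˣ) : K) = q ^ l.val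

namespace TaftS

variable {K : Type u} [Field K] {m n : ℕ} {q : K} {hq : IsPrimitiveRoot q m}
  {ξ : rootsOfUnity n K} {t : ℕ}

theorem xi_zpow_congr (ξ : rootsOfUnity n K) {a b : ℤ} (hab : (a : ZMod n) = (b : ZMod n)) :
    ξ ^ a = ξ ^ b := by
  have hx : ξ ^ (n : ℤ) = 1 := by
    rw [zpow_natCast]
    exact Subtype.ext ((mem_rootsOfUnity n (ξ : Kˣ)).1 ξ.2)
  obtain ⟨c, hc⟩ := (ZMod.intCast_eq_intCast_iff_dvd_sub a b n).1 hab
  rw [show b = a + n * c by linarith, zpow_add, zpow_mul, hx, one_zpow, mul_one]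

theorem coe_zpow_mul (ξ : rootsOfUnity n K) (a b : ℤ) :
    (((ξ ^ (a * b) : rootsOfUnity n K) : Kˣ) : K) =
      (((ξ ^ a : rootsOfUnity n K) : Kˣ) : K) ^ b := by
  rw [zpow_mul]
  push_cast
  rfl

variable [NeZero m]

theorem q_zpow_congr (hq : IsPrimitiveRoot q m) {a b : ℤ} :
    q ^ a = q ^ b ↔ (a : ZMod m) = (b : ZMod m) := by
  have hq0 : q ≠ 0 := hq.ne_zero (NeZero.ne m)
  rw [eq_comm, ZMod.intCast_eq_intCast_iff_dvd_sub, ← hq.zpow_eq_one_iff_dvd, zpow_sub₀ hq0,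
    div_eq_one_iff_eq (zpow_ne_zero _ hq0)]

variable [NeZero n]

/-- The defining condition can be tested on arbitrary integer representatives. -/
theorem cond_iff (hq : IsPrimitiveRoot q m) (ξ : rootsOfUnity n K) (t : ℕ)
    (l : ZMod m) (s : (ZMod n)ˣ) (l' s' : ℤ) (hl : (l' : ZMod m) = l) (hs : (s' : ZMod n) = s) :
    (((ξ ^ ((t : ℤ) * (((s : ZMod n).val : ℤ) - 1)) : rootsOfUnity n K) : Kˣ) : K) = q ^ l.val ↔
      (((ξ ^ ((t : ℤ) * (s' - 1)) : rootsOfUnity n K) : Kˣ) : K) = q ^ l' := by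
  rw [xi_zpow_congr ξ (a := (t : ℤ) * (((s : ZMod n).val : ℤ) - 1)) (b := (t : ℤ) * (s' - 1))
    (by push_cast; rw [hs]; simp), ← zpow_natCast q l.val,
    (q_zpow_congr hq (a := (l.val : ℤ)) (b := l')).2 (by rw [hl]; simp)]

theorem cond_val (a : TaftS hq ξ t) :
    (((ξ ^ ((t : ℤ) * (((a.s : ZMod n).val : ℤ) - 1)) : rootsOfUnity n K) : Kˣ) : K) =
      q ^ (a.l.val : ℤ) :=
  (cond_iff hq ξ t a.l a.s _ _ (by simp) (by simp)).1 a.cond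

/-- For `(l, s)` in the set, the class of `r l` modulo `m` only depends on `r` modulo `n`. -/
theorem mul_l_congr (a : TaftS hq ξ t) {r r' : ℤ} (hr : (r : ZMod n) = (r' : ZMod n)) :
    (r : ZMod m) * a.l = (r' : ZMod m) * a.l := by
  have h2 : ∀ c : ℤ, (((ξ ^ ((t : ℤ) * (((a.s : ZMod n).val : ℤ) - 1) * c) :
      rootsOfUnity n K) : Kˣ) : K) = q ^ ((a.l.val : ℤ) * c) := by
    intro c
    rw [coe_zpow_mul, zpow_mul q, ← cond_val]
  have e := xi_zpow_congr ξ (a := (t : ℤ) * (((a.s : ZMod n).val : ℤ) - 1) * r)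
    (b := (t : ℤ) * (((a.s : ZMod n).val : ℤ) - 1) * r') (by push_cast; rw [hr])
  have e2 := h2 r
  rw [e, h2 r', q_zpow_congr hq] at e2
  push_cast at e2
  simpa [mul_comm] using e2.symm

/-- The product `(l, s)(l', s') = (l + s l', s s')`. -/
instance instMul : Mul (TaftS hq ξ t) where
  mul a b := ⟨a.l + ((a.s : ZMod n).val : ZMod m) * b.l, a.s * b.s, by
    rw [cond_iff hq ξ t _ _ ((a.l.val : ℤ) + b.l.val * (a.s : ZMod n).val)
      ((a.s : ZMod n).val * (b.s : ZMod n).val) (by simp [mul_comm]) (by simp)]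
    have hq0 : q ≠ 0 := hq.ne_zero (NeZero.ne m)
    rw [zpow_add₀ hq0, zpow_mul q, ← cond_val a, ← cond_val b, ← coe_zpow_mul,
      show (t : ℤ) * (((a.s : ZMod n).val : ℤ) * ((b.s : ZMod n).val : ℤ) - 1) =
        t * (((a.s : ZMod n).val : ℤ) - 1) +
        t * (((b.s : ZMod n).val : ℤ) - 1) * ((a.s : ZMod n).val : ℤ) by ring, zpow_add]
    push_cast
    rfl⟩

/-- The product can be computed with an arbitrary integer representative of `s`. -/
theorem mul_l (a b : TaftS hq ξ t) (r : ℤ) (hr : (r : ZMod n) = a.s) :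
    (a * b).l = a.l + (r : ZMod m) * b.l := by
  have := b.mul_l_congr (r := (a.s : ZMod n).val) (r' := r) (by simp [hr])
  rw [← this, Int.cast_natCast]
  rfl

theorem mul_s (a b : TaftS hq ξ t) : (a * b).s = a.s * b.s := rfl

/-- The unit `(0, 1)`. -/
instance instOne : One (TaftS hq ξ t) where
  one := ⟨0, 1, by rw [cond_iff hq ξ t _ _ 0 1 (by simp) (by simp)]; simp⟩

theorem one_l : (1 : TaftS hq ξ t).l = 0 := rfl

theorem one_s : (1 : TaftS hq ξ t).s = 1 := rfl

/-- The inverse `(l, s)⁻¹ = (-l s', s')`, where `s' = s⁻¹`. -/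
instance instInv : Inv (TaftS hq ξ t) where
  inv a := ⟨-(a.l * (((a.s⁻¹ : (ZMod n)ˣ) : ZMod n).val : ZMod m)), a.s⁻¹, by
    set r := ((a.s⁻¹ : (ZMod n)ˣ) : ZMod n).val with hr
    have hr' : (r : ZMod n) = ((a.s⁻¹ : (ZMod n)ˣ) : ZMod n) := by
      rw [hr, ZMod.natCast_zmod_val]
    rw [cond_iff hq ξ t _ _ ((a.l.val : ℤ) * -r) r (by simp) (by rw [← hr', Int.cast_natCast]),
      zpow_mul q, ← cond_val a, ← coe_zpow_mul,
      xi_zpow_congr ξ (b := (t : ℤ) * (((a.s : ZMod n).val : ℤ) - 1) * -r)]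
    have h1 : (a.s : ZMod n) * (r : ZMod n) = 1 := by rw [hr', Units.mul_inv]
    rw [hr'] at h1
    push_cast
    rw [hr', ZMod.natCast_zmod_val]
    linear_combination (t : ZMod n) * h1⟩

theorem inv_l (a : TaftS hq ξ t) :
    a⁻¹.l = -(a.l * (((a.s⁻¹ : (ZMod n)ˣ) : ZMod n).val : ZMod m)) := rfl

theorem inv_s (a : TaftS hq ξ t) : a⁻¹.s = a.s⁻¹ := rfl

instance instGroup : Group (TaftS hq ξ t) :=
  Group.ofLeftAxioms
    (by
      intro a b c
      ext1
      · rw [mul_l _ c (((a.s : ZMod n).val : ℤ) * (b.s : ZMod n).val) (by simp [mul_s]),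
          mul_l a b (a.s : ZMod n).val (by simp), mul_l a (b * c) (a.s : ZMod n).val (by simp),
          mul_l b c (b.s : ZMod n).val (by simp)]
        push_cast
        ring
      · simp only [mul_s, mul_assoc])
    (by
      intro a
      ext1
      · rw [mul_l 1 a 1 (by simp [one_s]), one_l]
        simp
      · rw [mul_s, one_s, one_mul])
    (by
      intro a
      ext1
      · rw [mul_l a⁻¹ a (((a.s⁻¹ : (ZMod n)ˣ) : ZMod n).val) (by simp [inv_s]), inv_l, one_l,
          Int.cast_natCast]
        ring
      · rw [mul_s, inv_s, inv_mul_cancel, one_s])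

end TaftS

/-! The algebra has the basis gᵃ hᵇ xᶜ with a mod n, b mod m and c < m. Reordering words shows that
these monomials span; the left regular representation, written in coordinates, shows that they are
independent. The q-binomial theorem then gives Δ on the basis, and coefficients can be compared in
the tensor square.

Such a comparison shows that every group-like element is some gⁱ hʲ
(`exists_eq_monomial_of_isGroupLikeElem`). So an automorphism φ sends g to some gˢ hˡ and h to a
group-like k, and φ(x) satisfies Δ(φ(x)) = φ(x) ⊗ k + 1 ⊗ φ(x) and φ(x) k = q k φ(x). These two
equations force φ(x) = r xᶜ and k = hᶜ with 0 < c < m (`eq_smul_x_pow_of_skewPrimitive`). If c ≥ 2,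
then φ would kill xᵐ⁻¹ ≠ 0; hence c = 1, φ(h) = h and φ(x) = r x.

The relation g x = ω x g now reads ωˢ = ω qˡ, which for ω = ξᵗ is the condition defining S^t, and s
is a unit mod n because φ is invertible. Conversely each (r, l, s) of this kind defines an
endomorphism (`endHom`). Composition reverses the product of parameters, so sending a parameter to
the endomorphism of its inverse gives a group isomorphism. -/

theorem ZMod.pow_val_add_one {M : Type*} [Monoid M] {k : ℕ} {a : M} (ha : a ^ k = 1)
    (b : ZMod k) [NeZero k] : a ^ (b + 1).val = a ^ b.val * a := by
  rw [← pow_succ]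
  refine pow_eq_pow_of_modEq ?_ ha
  rw [← ZMod.natCast_eq_natCast_iff]
  simp

namespace QTaft

variable {K : Type u} [Field K] {m n : ℕ} {q : K} (hq : IsPrimitiveRoot q m)
  (ω : rootsOfUnity n K)

/-! ### A basis of monomials -/

/-- The monomial `gᵃ hᵇ xᶜ`. -/
noncomputable def monomial (a b c : ℕ) : QTaft hq ω := g hq ω ^ a * h hq ω ^ b * x hq ω ^ c

theorem monomial_zero : monomial hq ω 0 0 0 = 1 := by simp [monomial]

theorem monomial_one_zero_zero : monomial hq ω 1 0 0 = g hq ω := by simp [monomial]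

theorem monomial_zero_one_zero : monomial hq ω 0 1 0 = h hq ω := by simp [monomial]

theorem monomial_zero_zero_one : monomial hq ω 0 0 1 = x hq ω := by simp [monomial]

theorem monomial_congr {a a' b b' : ℕ} (c : ℕ) (ha : (a : ZMod n) = a') (hb : (b : ZMod m) = b') :
    monomial hq ω a b c = monomial hq ω a' b' c := by
  rw [ZMod.natCast_eq_natCast_iff] at ha hb
  rw [monomial, monomial, pow_eq_pow_of_modEq ha (g_pow hq ω),
    pow_eq_pow_of_modEq hb (h_pow hq ω)]

theorem monomial_eq_zero (a b : ℕ) {c : ℕ} (hc : m ≤ c) : monomial hq ω a b c = 0 := by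
  rw [monomial, pow_eq_zero_of_le hc (x_pow hq ω), mul_zero]

theorem g_mul_monomial (a b c : ℕ) :
    g hq ω * monomial hq ω a b c = monomial hq ω (a + 1) b c := by
  simp only [monomial, pow_succ', mul_assoc]

theorem h_mul_monomial (a b c : ℕ) :
    h hq ω * monomial hq ω a b c = monomial hq ω a (b + 1) c := by
  have e : h hq ω * g hq ω ^ a = g hq ω ^ a * h hq ω := (Commute.pow_right (h_mul_g hq ω) a).eq
  simp only [monomial, pow_succ', ← mul_assoc, e]

theorem monomial_mul_monomial_zero (i j a b c : ℕ) :
    monomial hq ω i j 0 * monomial hq ω a b c = monomial hq ω (i + a) (j + b) c := by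
  have e : h hq ω ^ j * g hq ω ^ a = g hq ω ^ a * h hq ω ^ j :=
    (Commute.pow_pow (h_mul_g hq ω) j a).eq
  rw [monomial, monomial, monomial, pow_zero, mul_one, pow_add, pow_add,
    mul_assoc (g hq ω ^ i), ← mul_assoc (h hq ω ^ j), ← mul_assoc (h hq ω ^ j), e]
  simp only [mul_assoc]

theorem monomial_zero_pow (i j k : ℕ) :
    monomial hq ω i j 0 ^ k = monomial hq ω (i * k) (j * k) 0 := by
  induction k with
  | zero => simp [monomial_zero]
  | succ k ih => rw [pow_succ, ih, monomial_mul_monomial_zero, mul_add_one, mul_add_one]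

theorem inv_mul_self_coe : ((ω⁻¹ : Kˣ) : K) * ((ω : Kˣ) : K) = 1 := by
  rw [← Units.val_mul]; simp

theorem inv_coe_pow_eq_one : (((ω : Kˣ)⁻¹ : Kˣ) : K) ^ n = 1 := by
  have := (mem_rootsOfUnity n (ω : Kˣ)).1 ω.2
  rw [← Units.val_pow_eq_pow_val, inv_pow, this]; simp

theorem coe_pow_eq_one : ((ω : Kˣ) : K) ^ n = 1 :=
  (mem_rootsOfUnity' n (ω : Kˣ)).1 ω.2

theorem x_mul_g :
    x hq ω * g hq ω = (((ω : Kˣ)⁻¹ : Kˣ) : K) • (g hq ω * x hq ω) := by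
  rw [g_mul_x, smul_smul, inv_mul_self_coe, one_smul]

theorem x_mul_monomial (a b c : ℕ) : x hq ω * monomial hq ω a b c =
    ((((ω : Kˣ)⁻¹ : Kˣ) : K) ^ a * q ^ b) • monomial hq ω a b (c + 1) := by
  rw [monomial, monomial, ← mul_assoc, ← mul_assoc, TaftAux.mul_pow_of_qcomm (x_mul_g hq ω),
    smul_mul_assoc, mul_assoc (_ ^ a), TaftAux.mul_pow_of_qcomm (x_mul_h hq ω), mul_smul_comm,
    smul_smul, smul_mul_assoc, pow_succ' _ c]
  simp only [mul_assoc]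

theorem monomial_mul_monomial (a b c i j : ℕ) :
    monomial hq ω a b c * monomial hq ω i j 0 =
      (((((ω : Kˣ)⁻¹ : Kˣ) : K) ^ i) ^ c * (q ^ j) ^ c) • monomial hq ω (a + i) (b + j) c := by
  have e1 := TaftAux.pow_mul_of_qcomm (TaftAux.mul_pow_of_qcomm (x_mul_g hq ω) i) c
  have e2 := TaftAux.pow_mul_of_qcomm (TaftAux.mul_pow_of_qcomm (x_mul_h hq ω) j) c
  have e3 : monomial hq ω a b c = monomial hq ω a b 0 * x hq ω ^ c := by simp [monomial]
  have e4 : x hq ω ^ c * monomial hq ω i j 0 =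
      (((((ω : Kˣ)⁻¹ : Kˣ) : K) ^ i) ^ c * (q ^ j) ^ c) • monomial hq ω i j c := by
    simp only [monomial, pow_zero, mul_one]
    rw [← mul_assoc, e1, smul_mul_assoc, mul_assoc, e2, mul_smul_comm, smul_smul, mul_assoc]
  rw [e3, mul_assoc, e4, mul_smul_comm, monomial_mul_monomial_zero]

/-! ### Independence of the monomials through the regular representation. -/

/-- The action of the generators in the left regular representation, in coordinates. -/
noncomputable def regularGen (q : K) (m : ℕ) (ω : rootsOfUnity n K) :
    QTaftGen → Module.End K (ZMod n × ZMod m × ℕ →₀ K)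
  | .g => Finsupp.linearCombination K fun I => Finsupp.single (I.1 + 1, I.2.1, I.2.2) 1
  | .h => Finsupp.linearCombination K fun I => Finsupp.single (I.1, I.2.1 + 1, I.2.2) 1
  | .x => Finsupp.linearCombination K fun I =>
      -- The weight is the scalar produced by moving x to the right past gᵃ hᵇ. The exponent of x
      -- ranges over all of ℕ, and this cutoff encodes xᵐ = 0.
      if I.2.2 + 1 < m then Finsupp.single (I.1, I.2.1, I.2.2 + 1)
        ((((ω : Kˣ)⁻¹ : Kˣ) : K) ^ I.1.val * q ^ I.2.1.val) else 0

theorem regularGen_g_pow (k : ℕ) (a : ZMod n) (b : ZMod m) (c : ℕ) :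
    (regularGen q m ω .g ^ k) (Finsupp.single (a, b, c) 1) = Finsupp.single (a + k, b, c) 1 := by
  induction k with
  | zero => simp
  | succ k ih => rw [pow_succ', Module.End.mul_apply, ih]; simp [regularGen, add_assoc]

theorem regularGen_h_pow (k : ℕ) (a : ZMod n) (b : ZMod m) (c : ℕ) :
    (regularGen q m ω .h ^ k) (Finsupp.single (a, b, c) 1) = Finsupp.single (a, b + k, c) 1 := by
  induction k with
  | zero => simp
  | succ k ih => rw [pow_succ', Module.End.mul_apply, ih]; simp [regularGen, add_assoc]

/-- The alternative k = 0 is needed because the zeroth power is the identity even on the superfluous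
vectors with c ≥ m. -/
theorem regularGen_x_pow (k : ℕ) (a : ZMod n) (b : ZMod m) (c : ℕ) :
    (regularGen q m ω .x ^ k) (Finsupp.single (a, b, c) 1) =
      if k = 0 ∨ c + k < m then Finsupp.single (a, b, c + k)
        (((((ω : Kˣ)⁻¹ : Kˣ) : K) ^ a.val * q ^ b.val) ^ k) else 0 := by
  induction k with
  | zero => simp
  | succ k ih =>
    rw [pow_succ', Module.End.mul_apply, ih]
    by_cases hk : c + k + 1 < m
    · rw [if_pos (by omega), if_pos (by omega)]
      simp only [regularGen, Finsupp.linearCombination_single]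
      rw [if_pos hk, Finsupp.smul_single, smul_eq_mul, ← pow_succ, add_assoc]
    · rw [if_neg (by omega : ¬ (k + 1 = 0 ∨ c + (k + 1) < m))]
      split_ifs <;> simp [regularGen, hk]

variable [NeZero m] [NeZero n]

theorem regularGen_sat (hq : IsPrimitiveRoot q m) (ω : rootsOfUnity n K) : Sat n ω m q (regularGen q m ω) where
  g_pow := by
    ext ⟨a, b, c⟩ : 2
    simp [regularGen_g_pow]
  h_pow := by
    ext ⟨a, b, c⟩ : 2
    simp [regularGen_h_pow]
  x_pow := by
    ext ⟨a, b, c⟩ : 2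
    have := NeZero.ne m
    simp [regularGen_x_pow, this]
  x_mul_h := by
    ext ⟨a, b, c⟩ : 2
    by_cases hc : c + 1 < m
    -- Replacing b by b + 1 multiplies the weight by q, even when the representative of b wraps
    -- around, because qᵐ = 1.
    · simp only [regularGen, LinearMap.comp_apply, Finsupp.lsingle_apply, Module.End.mul_apply,
        LinearMap.smul_apply, Finsupp.linearCombination_single, hc, if_true,
        ZMod.pow_val_add_one hq.pow_eq_one, Finsupp.smul_single, smul_eq_mul, one_mul]
      congr 1
      ring
    · simp [regularGen, hc]
  h_mul_g := by
    ext ⟨a, b, c⟩ : 2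
    simp [regularGen]
  g_mul_x := by
    ext ⟨a, b, c⟩ : 2
    by_cases hc : c + 1 < m
    · have := inv_mul_self_coe ω
      simp only [regularGen, LinearMap.comp_apply, Finsupp.lsingle_apply, Module.End.mul_apply,
        LinearMap.smul_apply, Finsupp.linearCombination_single, hc, if_true,
        ZMod.pow_val_add_one (inv_coe_pow_eq_one ω), Finsupp.smul_single, smul_eq_mul, one_mul]
      congr 1
      linear_combination (-((((ω : Kˣ)⁻¹ : Kˣ) : K) ^ a.val * q ^ b.val)) * this
    · simp [regularGen, hc]

/-- The left regular representation in coordinates. -/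
noncomputable def regular : QTaft hq ω →ₐ[K] Module.End K (ZMod n × ZMod m × ℕ →₀ K) :=
  lift hq ω (regularGen_sat hq ω)

@[simp] theorem regular_gen (i : QTaftGen) : regular hq ω (gen hq ω i) = regularGen q m ω i :=
  lift_gen hq ω _ i

/-- The linear combination of monomials with given coefficients. -/
noncomputable def ofCoords : (ZMod n × ZMod m × ℕ →₀ K) →ₗ[K] QTaft hq ω :=
  Finsupp.linearCombination K fun I => monomial hq ω I.1.val I.2.1.val I.2.2

theorem ofCoords_regularGen (i : QTaftGen) (v : ZMod n × ZMod m × ℕ →₀ K) :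
    ofCoords hq ω (regularGen q m ω i v) = gen hq ω i * ofCoords hq ω v := by
  suffices h : ofCoords hq ω ∘ₗ regularGen q m ω i =
      LinearMap.mulLeft K (gen hq ω i) ∘ₗ ofCoords hq ω from LinearMap.congr_fun h v
  ext ⟨a, b, c⟩
  rcases i with _ | _ | _
  · simp only [ofCoords, regularGen, LinearMap.comp_apply, Finsupp.lsingle_apply,
      Finsupp.linearCombination_single, one_smul, LinearMap.mulLeft_apply, g_mul_monomial]
    exact monomial_congr hq ω c (by simp) rfl
  · simp only [ofCoords, regularGen, LinearMap.comp_apply, Finsupp.lsingle_apply,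
      Finsupp.linearCombination_single, one_smul, LinearMap.mulLeft_apply, h_mul_monomial]
    exact monomial_congr hq ω c rfl (by simp)
  · simp only [ofCoords, regularGen, LinearMap.comp_apply, Finsupp.lsingle_apply,
      Finsupp.linearCombination_single, one_smul, LinearMap.mulLeft_apply, x_mul_monomial]
    split_ifs with hc
    · rw [Finsupp.linearCombination_single]
    · rw [monomial_eq_zero hq ω _ _ (not_lt.1 hc)]; simp

/-- `ofCoords` intertwines the coordinate action with left multiplication. Evaluated at the vector
of the monomial 1, this makes `coords` a right inverse of `ofCoords`, so the monomials span. -/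
theorem ofCoords_regular (t : QTaft hq ω) (v : ZMod n × ZMod m × ℕ →₀ K) :
    ofCoords hq ω (regular hq ω t v) = t * ofCoords hq ω v := by
  have ht : t ∈ Algebra.adjoin K (Set.range (gen hq ω)) := by rw [adjoin_gen]; trivial
  induction ht using Algebra.adjoin_induction generalizing v with
  | mem t ht => obtain ⟨i, rfl⟩ := ht; rw [regular_gen, ofCoords_regularGen]
  | algebraMap r => simp [Algebra.algebraMap_eq_smul_one]
  | add x y _ _ hx hy => simp [hx, hy, add_mul]
  | mul x y _ _ hx hy => simp [hx, hy, mul_assoc]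

/-- The coordinates of an element with respect to the monomials `gᵃ hᵇ xᶜ`. -/
noncomputable def coords : QTaft hq ω →ₗ[K] (ZMod n × ZMod m × ℕ →₀ K) :=
  LinearMap.applyₗ (Finsupp.single (0, 0, 0) 1) ∘ₗ (regular hq ω).toLinearMap

theorem ofCoords_coords (t : QTaft hq ω) : ofCoords hq ω (coords hq ω t) = t := by
  change ofCoords hq ω (regular hq ω t _) = t
  rw [ofCoords_regular]
  simp [ofCoords, monomial_zero]

theorem coords_monomial_of_lt (a b : ℕ) {c : ℕ} (hc : c < m) :
    coords hq ω (monomial hq ω a b c) = Finsupp.single ((a : ZMod n), (b : ZMod m), c) 1 := by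
  change regular hq ω _ _ = _
  rw [monomial, map_mul, map_mul, map_pow, map_pow, map_pow, regular_gen, regular_gen, regular_gen,
    Module.End.mul_apply, Module.End.mul_apply, regularGen_x_pow, if_pos (by omega)]
  simp [regularGen_h_pow, regularGen_g_pow]

/-! ### Coefficient functionals and extensionality. -/

/-- The coefficient of `gᵃ hᵇ xᶜ`. -/
noncomputable def coeff (a : ZMod n) (b : ZMod m) (c : ℕ) : QTaft hq ω →ₗ[K] K :=
  Finsupp.lapply (a, b, c) ∘ₗ coords hq ω

theorem coeff_monomial (a b c : ℕ) (a' : ZMod n) (b' : ZMod m) (c' : ℕ) :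
    coeff hq ω a' b' c' (monomial hq ω a b c) =
      if (a : ZMod n) = a' ∧ (b : ZMod m) = b' ∧ c = c' ∧ c < m then 1 else 0 := by
  by_cases hc : c < m
  · change coords hq ω _ _ = _
    rw [coords_monomial_of_lt hq ω a b hc, Finsupp.single_apply]
    simp [hc]
  · rw [monomial_eq_zero hq ω a b (not_lt.1 hc)]
    simp [hc]

/-- Linear maps agreeing on monomials are equal. -/
theorem linearMap_ext {W : Type*} [AddCommGroup W] [Module K W] {φ ψ : QTaft hq ω →ₗ[K] W}
    (e : ∀ a b c, c < m → φ (monomial hq ω a b c) = ψ (monomial hq ω a b c)) : φ = ψ := by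
  have : φ ∘ₗ ofCoords hq ω = ψ ∘ₗ ofCoords hq ω := by
    ext ⟨a, b, c⟩
    simp only [ofCoords, LinearMap.comp_apply, Finsupp.lsingle_apply,
      Finsupp.linearCombination_single, one_smul]
    by_cases hc : c < m
    · exact e _ _ _ hc
    · rw [monomial_eq_zero hq ω _ _ (not_lt.1 hc), map_zero, map_zero]
  ext t
  rw [← ofCoords_coords hq ω t]
  exact LinearMap.congr_fun this _

theorem ext_coeff {y z : QTaft hq ω} (e : ∀ a b c, coeff hq ω a b c y = coeff hq ω a b c z) :
    y = z := by
  rw [← ofCoords_coords hq ω y, ← ofCoords_coords hq ω z]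
  congr 1
  ext ⟨a, b, c⟩
  exact e a b c

theorem coeff_eq_zero (a : ZMod n) (b : ZMod m) {c : ℕ} (hc : m ≤ c) (y : QTaft hq ω) :
    coeff hq ω a b c y = 0 := by
  suffices h : coeff hq ω a b c = 0 by rw [h]; rfl
  refine linearMap_ext hq ω fun a' b' c' hc' => ?_
  rw [coeff_monomial, if_neg (by omega)]
  rfl

end QTaft

namespace QTaft

variable {K : Type u} [Field K] {m n : ℕ} {q : K} (hq : IsPrimitiveRoot q m)
  (ω : rootsOfUnity n K) [NeZero m]

/-! ### The comultiplication in coordinates -/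

/-- The q-binomial theorem applies to Δ(x) = x ⊗ h + 1 ⊗ x, since the two summands q-commute. -/
theorem comul_monomial (a b c : ℕ) : Coalgebra.comul (R := K) (monomial hq ω a b c) =
    ∑ k ∈ Finset.range (c + 1), TaftAux.gaussBinom q c k •
      (monomial hq ω a b k ⊗ₜ[K] monomial hq ω a (b + k) (c - k)) := by
  have e : ((1 : QTaft hq ω) ⊗ₜ[K] x hq ω) * (x hq ω ⊗ₜ[K] h hq ω) =
      q • ((x hq ω ⊗ₜ[K] h hq ω) * ((1 : QTaft hq ω) ⊗ₜ[K] x hq ω)) := by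
    simp [x_mul_h]
  rw [monomial, Bialgebra.comul_mul, Bialgebra.comul_mul, Bialgebra.comul_pow,
    Bialgebra.comul_pow, Bialgebra.comul_pow, comul_gen, comul_gen, comul_gen]
  simp only [comulGen]
  rw [TaftAux.add_pow_of_qcomm e, Finset.mul_sum]
  refine Finset.sum_congr rfl fun k _ => ?_
  simp only [Algebra.TensorProduct.tmul_pow, Algebra.TensorProduct.tmul_mul_tmul, mul_smul_comm,
    one_pow, mul_one, monomial, pow_add, mul_assoc]

theorem counit_monomial (a b c : ℕ) :
    Coalgebra.counit (R := K) (monomial hq ω a b c) = if c = 0 then 1 else 0 := by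
  rw [monomial, Bialgebra.counit_mul, Bialgebra.counit_mul, Bialgebra.counit_pow,
    Bialgebra.counit_pow, Bialgebra.counit_pow, counit_gen, counit_gen, counit_gen]
  simp [counitGen, zero_pow_eq]

variable [NeZero n]

theorem natCast_eq_of_monomial_eq {a b a' b' c : ℕ} (hc : c < m)
    (e : monomial hq ω a b c = monomial hq ω a' b' c) :
    (a : ZMod n) = a' ∧ (b : ZMod m) = b' := by
  have := congrArg (coeff hq ω a' b' c) e
  rw [coeff_monomial, coeff_monomial] at this
  by_contra hne
  rw [if_neg (fun H => hne ⟨H.1, H.2.1⟩), if_pos ⟨rfl, rfl, rfl, hc⟩] at this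
  exact zero_ne_one this

theorem monomial_ne_zero (a b : ℕ) {c : ℕ} (hc : c < m) : monomial hq ω a b c ≠ 0 := by
  intro e
  have := congrArg (coeff hq ω a b c) e
  rw [coeff_monomial, if_pos ⟨rfl, rfl, rfl, hc⟩, map_zero] at this
  exact one_ne_zero this

theorem coeff_one (a : ZMod n) (b : ZMod m) (c : ℕ) :
    coeff hq ω a b c 1 = if a = 0 ∧ b = 0 ∧ c = 0 then 1 else 0 := by
  have := NeZero.pos m
  rw [← monomial_zero, coeff_monomial]
  refine if_congr ?_ rfl rfl
  simp only [Nat.cast_zero, this, and_true, eq_comm]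

/-- In x-degree 0 nothing has to be moved past a power of x, so right multiplication by gⁱ hʲ is a
pure shift, exactly like left multiplication. In higher degree a scalar would appear. -/
theorem coeff_mul_monomial (a : ZMod n) (b : ZMod m) (i j : ℕ) (y : QTaft hq ω) :
    coeff hq ω (a + i) (b + j) 0 (y * monomial hq ω i j 0) = coeff hq ω a b 0 y := by
  suffices h : coeff hq ω (a + i) (b + j) 0 ∘ₗ LinearMap.mulRight K (monomial hq ω i j 0) =
      coeff hq ω a b 0 from LinearMap.congr_fun h y
  refine linearMap_ext hq ω fun a' b' c' hc' => ?_
  rw [LinearMap.comp_apply, LinearMap.mulRight_apply, monomial_mul_monomial, map_smul,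
    coeff_monomial, coeff_monomial]
  rcases Nat.eq_zero_or_pos c' with rfl | hc
  · simp
  · simp [hc.ne']

theorem coeff_monomial_mul (a : ZMod n) (b : ZMod m) (c i j : ℕ) (y : QTaft hq ω) :
    coeff hq ω (a + i) (b + j) c (monomial hq ω i j 0 * y) = coeff hq ω a b c y := by
  suffices h : coeff hq ω (a + i) (b + j) c ∘ₗ LinearMap.mulLeft K (monomial hq ω i j 0) =
      coeff hq ω a b c from LinearMap.congr_fun h y
  refine linearMap_ext hq ω fun a' b' c' hc' => ?_
  rw [LinearMap.comp_apply, LinearMap.mulLeft_apply, monomial_mul_monomial_zero,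
    coeff_monomial, coeff_monomial, add_comm i, add_comm j]
  simp

/-- The product of two coefficient functionals, as a functional on the tensor square. -/
noncomputable def coeffTensor (a : ZMod n) (b : ZMod m) (c : ℕ) (a' : ZMod n) (b' : ZMod m)
    (c' : ℕ) : QTaft hq ω ⊗[K] QTaft hq ω →ₗ[K] K :=
  LinearMap.mul' K K ∘ₗ TensorProduct.map (coeff hq ω a b c) (coeff hq ω a' b' c')

@[simp] theorem coeffTensor_tmul (a : ZMod n) (b : ZMod m) (c : ℕ) (a' : ZMod n) (b' : ZMod m)
    (c' : ℕ) (y z : QTaft hq ω) : coeffTensor hq ω a b c a' b' c' (y ⊗ₜ z) =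
      coeff hq ω a b c y * coeff hq ω a' b' c' z := rfl

/-- Each coordinate of Δ(y) comes from at most one coefficient of y. This turns equations in the
tensor square into scalar equations. -/
theorem coeffTensor_comul (a : ZMod n) (b : ZMod m) (c : ℕ) (a' : ZMod n) (b' : ZMod m) (c' : ℕ)
    (y : QTaft hq ω) : coeffTensor hq ω a b c a' b' c' (Coalgebra.comul (R := K) y) =
      (if a' = a ∧ b' = b + c then TaftAux.gaussBinom q (c + c') c else 0) *
        coeff hq ω a b (c + c') y := by
  suffices h : coeffTensor hq ω a b c a' b' c' ∘ₗ Coalgebra.comul (R := K) =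
      (if a' = a ∧ b' = b + c then TaftAux.gaussBinom q (c + c') c else 0) •
        coeff hq ω a b (c + c') from LinearMap.congr_fun h y
  refine linearMap_ext hq ω fun i j k hk => ?_
  rw [LinearMap.comp_apply, comul_monomial, map_sum, LinearMap.smul_apply, smul_eq_mul,
    coeff_monomial]
  simp only [map_smul, coeffTensor_tmul, coeff_monomial, smul_eq_mul]
  by_cases hkc : k = c + c'
  · subst hkc
    rw [Finset.sum_eq_single c]
    · have h1 : c < m := by omega
      have h2 : c' < m := by omega
      by_cases ha : (i : ZMod n) = a
      · by_cases hb : (j : ZMod m) = b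
        · subst ha hb
          simp [h1, h2, hk, eq_comm]
        · simp [hb]
      · simp [ha]
    · intro r _ hr
      simp [hr]
    · intro hc
      exact absurd (Finset.mem_range.2 (by omega)) hc
  · rw [if_neg (c := (i : ZMod n) = a ∧ _ ∧ k = c + c' ∧ _) (fun H => hkc H.2.2.1), mul_zero]
    refine Finset.sum_eq_zero fun r hr => ?_
    have := Finset.mem_range.1 hr
    by_cases hrc : r = c
    · rw [if_neg (c := _ ∧ _ ∧ k - r = c' ∧ _) (by omega)]
      simp
    · simp [hrc]

theorem exists_coeff_ne_zero {y : QTaft hq ω} (hy : y ≠ 0) :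
    ∃ a b c, coeff hq ω a b c y ≠ 0 := by
  by_contra! H
  exact hy (ext_coeff hq ω fun a b c => by rw [H, map_zero])

/-- Its contrapositive provides a group-like element with a nonzero coefficient in x-degree 0. -/
theorem counit_eq_zero {y : QTaft hq ω} (e : ∀ a b, coeff hq ω a b 0 y = 0) :
    Coalgebra.counit (R := K) y = 0 := by
  rw [← ofCoords_coords hq ω y, ofCoords, Finsupp.linearCombination_apply, Finsupp.sum, map_sum]
  refine Finset.sum_eq_zero fun I _ => ?_
  rw [map_smul, counit_monomial]
  split_ifs with h0
  · obtain ⟨a, b, c⟩ := I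
    obtain rfl : c = 0 := h0
    have : coords hq ω y (a, b, 0) = 0 := e a b
    rw [this, zero_smul]
  · rw [smul_zero]

/-! ### Group-like and skew-primitive elements -/

theorem exists_eq_monomial_of_isGroupLikeElem {y : QTaft hq ω} (hy : IsGroupLikeElem K y) :
    ∃ i j : ℕ, y = monomial hq ω i j 0 := by
  have key : ∀ a b c a' b' c', coeff hq ω a b c y * coeff hq ω a' b' c' y =
      (if a' = a ∧ b' = b + c then TaftAux.gaussBinom q (c + c') c else 0) *
        coeff hq ω a b (c + c') y := by
    intro a b c a' b' c'
    rw [← coeffTensor_comul, hy.comul_eq_tmul_self, coeffTensor_tmul]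
  obtain ⟨a, b, hab⟩ : ∃ a b, coeff hq ω a b 0 y ≠ 0 := by
    by_contra! H
    have := hy.counit_eq_one
    rw [counit_eq_zero hq ω H] at this
    exact zero_ne_one this
  refine ⟨a.val, b.val, ext_coeff hq ω fun a' b' c => ?_⟩
  -- The coefficient is a nonzero idempotent of K.
  have hone : coeff hq ω a b 0 y = 1 := by
    have := key a b 0 a b 0
    simp only [Nat.cast_zero, add_zero, and_self, if_true, TaftAux.gaussBinom_zero] at this
    exact mul_right_cancel₀ hab this
  rw [coeff_monomial]
  simp only [ZMod.natCast_zmod_val]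
  split_ifs with h
  · obtain ⟨rfl, rfl, rfl, -⟩ := h
    exact hone
  · by_contra hne
    -- Pairing a second nonzero coefficient with the first, in both orders, forces a' = a, b' = b
    -- and then c ≡ 0 mod m; since c < m, it is the same coefficient.
    have h1 := key a b 0 a' b' c
    have h2 := key a' b' c a b 0
    rw [hone, one_mul] at h1
    rw [hone, mul_one, add_zero] at h2
    have hb : a' = a ∧ b' = b := by
      by_contra H
      rw [if_neg (by simpa using H), zero_mul] at h1
      exact hne h1
    obtain ⟨rfl, rfl⟩ := hb
    have hc : (c : ZMod m) = 0 := by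
      by_contra H
      rw [if_neg (by simpa using H), zero_mul] at h2
      exact hne h2
    have hcm : c < m := by
      by_contra H
      exact hne (coeff_eq_zero hq ω _ _ (not_lt.1 H) y)
    rw [ZMod.natCast_eq_zero_iff] at hc
    exact h ⟨rfl, rfl, (Nat.eq_zero_of_dvd_of_lt hc hcm).symm, NeZero.pos m⟩

theorem eq_smul_x_pow_of_skewPrimitive (hq1 : q ≠ 1) {y : QTaft hq ω} (hy0 : y ≠ 0) {i j : ℕ}
    (hy : Coalgebra.comul (R := K) y = y ⊗ₜ[K] monomial hq ω i j 0 + 1 ⊗ₜ[K] y)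
    (hc : y * monomial hq ω i j 0 = q • (monomial hq ω i j 0 * y)) :
    ∃ (r : K) (c : ℕ), 0 < c ∧ c < m ∧ y = r • x hq ω ^ c ∧
      monomial hq ω i j 0 = h hq ω ^ c := by
  have hm0 := NeZero.pos m
  -- In x-degree 0 the q-commutation equates a coefficient with q times itself, and q ≠ 1. This
  -- excludes the trivial skew-primitives, the multiples of gⁱ hʲ - 1.
  have h0 : ∀ a b, coeff hq ω a b 0 y = 0 := by
    intro a b
    have := congrArg (coeff hq ω (a + i) (b + j) 0) hc
    rw [coeff_mul_monomial, map_smul, coeff_monomial_mul, smul_eq_mul] at this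
    have h2 : (1 - q) * coeff hq ω a b 0 y = 0 := by linear_combination this
    exact (mul_eq_zero.1 h2).resolve_left (sub_ne_zero.2 hq1.symm)
  have key : ∀ a b c a' b' c', coeff hq ω a b c y * coeff hq ω a' b' c' (monomial hq ω i j 0) +
      coeff hq ω a b c 1 * coeff hq ω a' b' c' y =
      (if a' = a ∧ b' = b + c then TaftAux.gaussBinom q (c + c') c else 0) *
        coeff hq ω a b (c + c') y := by
    intro a b c a' b' c'
    rw [← coeffTensor_comul, hy, map_add, coeffTensor_tmul, coeffTensor_tmul]
  have hne : ∀ a b c, coeff hq ω a b c y ≠ 0 →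
      0 < c ∧ c < m ∧ a = 0 ∧ b = 0 ∧ (i : ZMod n) = 0 ∧ (j : ZMod m) = c := by
    intro a b c hn
    have hc0 : 0 < c := by
      by_contra H
      obtain rfl : c = 0 := by omega
      exact hn (h0 a b)
    have hcm : c < m := by
      by_contra H
      exact hn (coeff_eq_zero hq ω _ _ (not_lt.1 H) y)
    -- The coordinate at 1 ⊗ gᵃ hᵇ xᶜ forces a = b = 0.
    have h1 := key 0 0 0 a b c
    rw [h0, zero_mul, zero_add, coeff_one, if_pos ⟨rfl, rfl, rfl⟩, one_mul, zero_add] at h1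
    have hab : a = 0 ∧ b = 0 := by
      by_contra H
      rw [if_neg (by simpa using H), zero_mul] at h1
      exact hn h1
    obtain ⟨rfl, rfl⟩ := hab
    -- The coordinate at xᶜ ⊗ hᶜ forces gⁱ hʲ = hᶜ. As c < m, the exponent c is therefore determined
    -- by j, so only one power of x occurs.
    have h2 := key 0 0 c 0 c 0
    rw [h0, mul_zero, add_zero, if_pos (by simp), add_zero, TaftAux.gaussBinom_self, one_mul,
      coeff_monomial] at h2
    refine ⟨hc0, hcm, rfl, rfl, ?_⟩
    by_contra H
    rw [if_neg (fun H' => H ⟨H'.1, H'.2.1⟩), mul_zero] at h2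
    exact hn h2.symm
  obtain ⟨a, b, c, habc⟩ := exists_coeff_ne_zero hq ω hy0
  obtain ⟨hc0, hcm, rfl, rfl, hi, hj⟩ := hne a b c habc
  refine ⟨coeff hq ω 0 0 c y, c, hc0, hcm, ext_coeff hq ω fun a' b' c' => ?_, ?_⟩
  · have e : x hq ω ^ c = monomial hq ω 0 0 c := by simp [monomial]
    rw [e, map_smul, coeff_monomial, smul_eq_mul]
    split_ifs with H
    · obtain ⟨ha, hb, rfl, -⟩ := H
      rw [mul_one, ← ha, ← hb, Nat.cast_zero, Nat.cast_zero]
    · rw [mul_zero]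
      by_contra hn
      obtain ⟨-, hcm', rfl, rfl, -, hj'⟩ := hne a' b' c' hn
      rw [hj, ZMod.natCast_eq_natCast_iff'] at hj'
      rw [Nat.mod_eq_of_lt hcm, Nat.mod_eq_of_lt hcm'] at hj'
      exact H ⟨by simp, by simp, hj', hcm⟩
  · rw [monomial_congr hq ω 0 (a' := 0) (b' := c) (by simpa using hi) hj]
    simp [monomial]

end QTaft

/-- Multiplying by ω = ξᵗ removes the integer exponent s - 1 and gives the form in which the
relation g x = ω x g yields the condition. -/
theorem TaftS.cond_iff_pow {K : Type u} [Field K] {m n : ℕ} [NeZero m] [NeZero n] {q : K}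
    (hq : IsPrimitiveRoot q m) (ξ : rootsOfUnity n K) (t : ℕ) (l : ZMod m) (s : (ZMod n)ˣ)
    (l' s' : ℕ) (hl : (l' : ZMod m) = l) (hs : (s' : ZMod n) = s) :
    (((ξ ^ ((t : ℤ) * (((s : ZMod n).val : ℤ) - 1)) : rootsOfUnity n K) : Kˣ) : K) = q ^ l.val ↔
      (((ξ ^ t : rootsOfUnity n K) : Kˣ) : K) ^ s' =
        (((ξ ^ t : rootsOfUnity n K) : Kˣ) : K) * q ^ l' := by
  rw [TaftS.cond_iff hq ξ t l s l' s' (by simpa using hl) (by simpa using hs), zpow_mul,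
    zpow_natCast ξ t, zpow_natCast]
  generalize ξ ^ t = ω
  have hω : ((ω : Kˣ) : K) ≠ 0 := (ω : Kˣ).ne_zero
  have e : (((ω ^ ((s' : ℤ) - 1) : rootsOfUnity n K) : Kˣ) : K) * ((ω : Kˣ) : K) =
      ((ω : Kˣ) : K) ^ s' := by
    have : ω ^ ((s' : ℤ) - 1) * ω = ω ^ s' := by rw [zpow_sub_one, inv_mul_cancel_right,
      zpow_natCast]
    rw [← Units.val_mul, ← Subgroup.coe_mul, this]
    simp
  rw [← e, mul_comm]
  exact ⟨fun h => by rw [h], fun h => mul_left_cancel₀ hω h⟩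

namespace QTaft

variable {K : Type u} [Field K] {m n : ℕ} {q : K} (hq : IsPrimitiveRoot q m)
  (ω : rootsOfUnity n K)

/-! ### The endomorphisms `g ↦ gˢ hˡ`, `h ↦ h`, `x ↦ r x` -/

/-- The images of the generators. -/
noncomputable def endGen (r : K) (s l : ℕ) : QTaftGen → QTaft hq ω
  | .g => monomial hq ω s l 0
  | .h => h hq ω
  | .x => r • x hq ω

theorem coe_pow_mul_inv_pow (s : ℕ) :
    ((ω : Kˣ) : K) ^ s * (((ω : Kˣ)⁻¹ : Kˣ) : K) ^ s = 1 := by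
  rw [← mul_pow, mul_comm, inv_mul_self_coe, one_pow]

variable [NeZero m]

variable {hq ω} in
theorem bialgHom_ext {φ ψ : QTaft hq ω →ₐc[K] QTaft hq ω}
    (e : ∀ i, φ (gen hq ω i) = ψ (gen hq ω i)) : φ = ψ := by
  have : (φ : QTaft hq ω →ₐ[K] QTaft hq ω) = ψ := algHom_ext e
  exact BialgHom.ext fun t => DFunLike.congr_fun this t

variable [NeZero n]

/-- The compatibility of `gˢ hˡ` with the relation `g x = ω x g`. -/
theorem monomial_mul_x_iff (hm : 1 < m) {r : K} (hr : r ≠ 0) (s l : ℕ) :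
    monomial hq ω s l 0 * (r • x hq ω) =
      ((ω : Kˣ) : K) • ((r • x hq ω) * monomial hq ω s l 0) ↔
    ((ω : Kˣ) : K) ^ s = ((ω : Kˣ) : K) * q ^ l := by
  have h1 := coe_pow_mul_inv_pow ω s
  have h2 : (((ω : Kˣ)⁻¹ : Kˣ) : K) ^ s ≠ 0 := pow_ne_zero _ (Units.ne_zero _)
  have e : monomial hq ω s l 0 * x hq ω = monomial hq ω s l 1 := by simp [monomial]
  rw [mul_smul_comm, e, smul_mul_assoc, x_mul_monomial, smul_comm _ r,
    (smul_right_injective _ hr).eq_iff, smul_smul]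
  constructor
  · intro H
    have := congrArg (coeff hq ω s l 1) H
    rw [map_smul, coeff_monomial, if_pos ⟨rfl, rfl, rfl, hm⟩, smul_eq_mul, mul_one] at this
    apply mul_right_cancel₀ h2
    linear_combination h1 + this
  · intro H
    rw [zero_add, ← one_smul K (monomial hq ω s l 1), smul_smul]
    congr 1
    linear_combination -h1 + (((ω : Kˣ)⁻¹ : Kˣ) : K) ^ s * H

theorem endGen_sat (hm : 1 < m) {r : K} (hr : r ≠ 0) {s l : ℕ}
    (hsl : ((ω : Kˣ) : K) ^ s = ((ω : Kˣ) : K) * q ^ l) : Sat n ω m q (endGen hq ω r s l) where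
  g_pow := by
    -- Raising ωˢ = ω qˡ to the n-th power gives m ∣ l n, so (gˢ hˡ)ⁿ = 1 needs no separate
    -- hypothesis.
    have e : q ^ (l * n) = 1 := by
      have := congrArg (· ^ n) hsl
      simp only [mul_pow, ← pow_mul, coe_pow_eq_one] at this
      rwa [mul_comm s, pow_mul, coe_pow_eq_one, one_pow, one_mul, eq_comm] at this
    simp only [endGen]
    rw [monomial_zero_pow, ← monomial_zero]
    refine monomial_congr hq ω 0 (by simp) ?_
    rw [Nat.cast_zero, ZMod.natCast_eq_zero_iff]
    exact hq.dvd_of_pow_eq_one _ e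
  h_pow := h_pow hq ω
  x_pow := by simp only [endGen]; rw [smul_pow, x_pow, smul_zero]
  x_mul_h := by
    simp only [endGen]
    rw [smul_mul_assoc, mul_smul_comm, x_mul_h, smul_comm]
  h_mul_g := by
    simp only [endGen]
    rw [← monomial_zero_one_zero, monomial_mul_monomial_zero, monomial_mul_monomial_zero,
      add_comm, add_comm 1]
  g_mul_x := (monomial_mul_x_iff hq ω hm hr s l).2 hsl

/-- The bialgebra endomorphism with `g ↦ gˢ hˡ`, `h ↦ h`, `x ↦ r x`. -/
noncomputable def endHom (hm : 1 < m) {r : K} (hr : r ≠ 0) {s l : ℕ}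
    (hsl : ((ω : Kˣ) : K) ^ s = ((ω : Kˣ) : K) * q ^ l) : QTaft hq ω →ₐc[K] QTaft hq ω :=
  BialgHom.ofAlgHom (lift hq ω (endGen_sat hq ω hm hr hsl))
    (algHom_ext fun i => by
      rcases i with _ | _ | _
      · simp [endGen, counitGen, counit_monomial]
      · simp [endGen, counitGen]
      · simp [endGen, counitGen])
    (algHom_ext fun i => by
      rcases i with _ | _ | _
      · simp [endGen, comulGen, comul_monomial, TaftAux.gaussBinom_zero]
      · simp [endGen, comulGen]
      · simp [endGen, comulGen, TensorProduct.smul_tmul'])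

theorem endHom_gen (hm : 1 < m) {r : K} (hr : r ≠ 0) {s l : ℕ}
    (hsl : ((ω : Kˣ) : K) ^ s = ((ω : Kˣ) : K) * q ^ l) (i : QTaftGen) :
    endHom hq ω hm hr hsl (gen hq ω i) = endGen hq ω r s l i :=
  lift_gen hq ω (endGen_sat hq ω hm hr hsl) i

theorem endHom_monomial (hm : 1 < m) {r : K} (hr : r ≠ 0) {s l : ℕ}
    (hsl : ((ω : Kˣ) : K) ^ s = ((ω : Kˣ) : K) * q ^ l) (a b : ℕ) :
    endHom hq ω hm hr hsl (monomial hq ω a b 0) = monomial hq ω (s * a) (l * a + b) 0 := by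
  rw [monomial, pow_zero, mul_one, map_mul, map_pow, map_pow, endHom_gen, endHom_gen]
  simp only [endGen]
  rw [monomial_zero_pow, ← monomial_zero_one_zero, monomial_zero_pow, monomial_mul_monomial_zero]
  simp

/-! ### Hopf automorphisms -/

theorem exists_hopfAut_apply_g (φ : HopfAut K (QTaft hq ω)) :
    ∃ s l : ℕ, φ (g hq ω) = monomial hq ω s l 0 :=
  exists_eq_monomial_of_isGroupLikeElem hq ω
    (IsGroupLikeElem.map φ ⟨by simp [counitGen], by simp [comulGen]⟩)

theorem hopfAut_apply_h_x (hm : 3 ≤ m) (φ : HopfAut K (QTaft hq ω)) :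
    φ (h hq ω) = h hq ω ∧ ∃ r : K, r ≠ 0 ∧ φ (x hq ω) = r • x hq ω := by
  have hx : ∀ c < m, x hq ω ^ c ≠ 0 := fun c hc => by
    have := monomial_ne_zero hq ω 0 0 hc
    simpa [monomial] using this
  have inj : ∀ y, φ y = 0 → y = 0 := fun y hy =>
    EquivLike.injective φ (by rw [hy, map_zero])
  obtain ⟨i, j, hij⟩ : ∃ i j : ℕ, φ (h hq ω) = monomial hq ω i j 0 :=
    exists_eq_monomial_of_isGroupLikeElem hq ω
      (IsGroupLikeElem.map φ ⟨by simp [counitGen], by simp [comulGen]⟩)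
  have hcomul : Coalgebra.comul (R := K) (φ (x hq ω)) =
      φ (x hq ω) ⊗ₜ[K] monomial hq ω i j 0 + 1 ⊗ₜ[K] φ (x hq ω) := by
    rw [← CoalgHomClass.map_comp_comul_apply, comul_gen]
    simp [comulGen, hij]
  have hrel : φ (x hq ω) * monomial hq ω i j 0 = q • (monomial hq ω i j 0 * φ (x hq ω)) := by
    rw [← hij, ← map_mul, x_mul_h, map_smul, map_mul]
  have hφx : φ (x hq ω) ≠ 0 := fun H => hx 1 (by omega) (by rw [pow_one]; exact inj _ H)
  obtain ⟨r, c, hc0, hcm, hxc, hhc⟩ := eq_smul_x_pow_of_skewPrimitive hq ω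
    (hq.ne_one (by omega)) hφx hcomul hrel
  -- If c ≥ 2 then c (m - 1) ≥ m, so φ(xᵐ⁻¹) = 0, against injectivity.
  obtain rfl : c = 1 := by
    by_contra hc1
    refine hx (m - 1) (by omega) (inj _ ?_)
    rw [map_pow, hxc, smul_pow, ← pow_mul, pow_eq_zero_of_le _ (x_pow hq ω), smul_zero]
    calc m ≤ 2 * (m - 1) := by omega
      _ ≤ c * (m - 1) := Nat.mul_le_mul_right _ (by omega)
  rw [pow_one] at hxc hhc
  exact ⟨by rw [hij, hhc], r, fun hr => hφx (by rw [hxc, hr, zero_smul]), hxc⟩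

/-- Since φ fixes h, the g-exponents of φ(g) and φ⁻¹(g) multiply to 1 modulo n. -/
theorem isUnit_of_hopfAut (hm : 3 ≤ m) (φ : HopfAut K (QTaft hq ω)) {s l : ℕ}
    (hφ : φ (g hq ω) = monomial hq ω s l 0) : IsUnit (s : ZMod n) := by
  obtain ⟨s', l', hψ⟩ := exists_hopfAut_apply_g hq ω φ⁻¹
  have e : φ (φ⁻¹ (g hq ω)) = g hq ω := by
    rw [← HopfAut.mul_apply, mul_inv_cancel]; rfl
  have ee : φ (monomial hq ω s' l' 0) = monomial hq ω (s * s') (l * s' + l') 0 := by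
    rw [monomial, pow_zero, mul_one, map_mul, map_pow, map_pow, hφ,
      (hopfAut_apply_h_x hq ω hm φ).1, monomial_zero_pow, ← monomial_zero_one_zero,
      monomial_zero_pow, monomial_mul_monomial_zero]
    simp
  rw [hψ, ee, ← monomial_one_zero_zero] at e
  have := (natCast_eq_of_monomial_eq hq ω (NeZero.pos m) e).1
  push_cast at this
  exact IsUnit.of_mul_eq_one _ this

/-! ### The group isomorphism. -/

section Group

variable {ξ : rootsOfUnity n K} {t : ℕ}

/-- The bialgebra endomorphism attached to an element of `K^* × S^t_{m,n}(q)`. -/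
noncomputable def taftEnd (hm : 1 < m) (p : Kˣ × TaftS hq ξ t) :
    QTaft hq (ξ ^ t) →ₐc[K] QTaft hq (ξ ^ t) :=
  endHom hq (ξ ^ t) hm p.1.ne_zero
    ((TaftS.cond_iff_pow hq ξ t p.2.l p.2.s p.2.l.val (p.2.s : ZMod n).val (by simp) (by simp)).1 p.2.cond)

theorem taftEnd_gen (hm : 1 < m) (p : Kˣ × TaftS hq ξ t) (i : QTaftGen) :
    taftEnd hq hm p (gen hq (ξ ^ t) i) =
      endGen hq (ξ ^ t) p.1 (p.2.s : ZMod n).val p.2.l.val i :=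
  endHom_gen ..

theorem taftEnd_one (hm : 1 < m) :
    taftEnd hq hm (1 : Kˣ × TaftS hq ξ t) = BialgHom.id K (QTaft hq (ξ ^ t)) := by
  refine bialgHom_ext fun i => ?_
  rw [taftEnd_gen]
  rcases i with _ | _ | _
  · change monomial _ _ _ _ _ = g _ _
    rw [← monomial_one_zero_zero]
    exact monomial_congr _ _ _ (by simp [TaftS.one_s]) (by simp [TaftS.one_l])
  · rfl
  · change _ • x _ _ = x _ _
    simp

/-- The order is reversed: applying p to g^{s'} h^{l'} gives h-exponent l' + s' l, which is the
first component of (l', s')(l, s). -/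
theorem taftEnd_mul (hm : 1 < m) (p p' : Kˣ × TaftS hq ξ t) :
    taftEnd hq hm (p' * p) = (taftEnd hq hm p).comp (taftEnd hq hm p') := by
  refine bialgHom_ext fun i => ?_
  rw [BialgHom.comp_apply, taftEnd_gen, taftEnd_gen]
  rcases i with _ | _ | _
  · simp only [endGen]
    rw [taftEnd, endHom_monomial]
    refine monomial_congr _ _ _ ?_ ?_
    · simp [TaftS.mul_s, mul_comm]
    · rw [Prod.snd_mul, ZMod.natCast_zmod_val,
        TaftS.mul_l p'.2 p.2 ((p'.2.s : ZMod n).val : ℤ) (by simp)]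
      push_cast
      simp only [ZMod.natCast_zmod_val]
      ring
  · exact (taftEnd_gen hq hm p .h).symm
  · simp only [endGen]
    rw [map_smul, taftEnd_gen, endGen, smul_smul]
    simp

/-- The Hopf automorphism attached to an element of `K^* × S^t_{m,n}(q)`. -/
noncomputable def taftAut (hm : 1 < m) : Kˣ × TaftS hq ξ t →* HopfAut K (QTaft hq (ξ ^ t)) where
  -- Inverting p turns the antihomomorphism `taftEnd` into a homomorphism.
  toFun p := BialgEquiv.ofBialgHom (taftEnd hq hm p⁻¹) (taftEnd hq hm p)
    (by rw [← taftEnd_mul, mul_inv_cancel, taftEnd_one])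
    (by rw [← taftEnd_mul, inv_mul_cancel, taftEnd_one])
  map_one' := BialgEquiv.ext fun y => by
    change taftEnd hq hm 1⁻¹ y = y
    rw [inv_one, taftEnd_one]; rfl
  map_mul' p p' := BialgEquiv.ext fun y => by
    change taftEnd hq hm (p * p')⁻¹ y = taftEnd hq hm p⁻¹ (taftEnd hq hm p'⁻¹ y)
    rw [mul_inv_rev, taftEnd_mul]; rfl

theorem taftAut_apply (hm : 1 < m) (p : Kˣ × TaftS hq ξ t) (y : QTaft hq (ξ ^ t)) :
    taftAut hq hm p y = taftEnd hq hm p⁻¹ y := rfl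

theorem taftEnd_injective (hm : 1 < m) :
    Function.Injective (taftEnd hq hm : Kˣ × TaftS hq ξ t → _) := by
  intro p p' e
  have hg := DFunLike.congr_fun e (g hq (ξ ^ t))
  have hx := DFunLike.congr_fun e (x hq (ξ ^ t))
  rw [taftEnd_gen, taftEnd_gen] at hg hx
  simp only [endGen] at hg hx
  obtain ⟨hs, hl⟩ := natCast_eq_of_monomial_eq hq (ξ ^ t) (NeZero.pos m) hg
  rw [ZMod.natCast_zmod_val, ZMod.natCast_zmod_val] at hs hl
  have hx0 : x hq (ξ ^ t) ≠ 0 := by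
    rw [← monomial_zero_zero_one]; exact monomial_ne_zero _ _ _ _ hm
  exact Prod.ext (Units.ext (smul_left_injective K hx0 hx)) (TaftS.ext hl (Units.ext hs))

theorem exists_taftEnd_eq (hm : 3 ≤ m) (φ : HopfAut K (QTaft hq (ξ ^ t))) :
    ∃ p : Kˣ × TaftS hq ξ t, ∀ y, taftEnd hq (by omega) p y = φ y := by
  obtain ⟨hh, r, hr, hx⟩ := hopfAut_apply_h_x hq (ξ ^ t) hm φ
  obtain ⟨s, l, hg⟩ := exists_hopfAut_apply_g hq (ξ ^ t) φ
  obtain ⟨u, hu⟩ := isUnit_of_hopfAut hq (ξ ^ t) hm φ hg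
  have hrel : φ (g hq (ξ ^ t)) * φ (x hq (ξ ^ t)) =
      (((ξ ^ t : rootsOfUnity n K) : Kˣ) : K) • (φ (x hq (ξ ^ t)) * φ (g hq (ξ ^ t))) := by
    rw [← map_mul, g_mul_x, map_smul, map_mul]
  rw [hg, hx, monomial_mul_x_iff hq (ξ ^ t) (by omega) hr] at hrel
  refine ⟨(Units.mk0 r hr, ⟨l, u, (TaftS.cond_iff_pow hq ξ t l u l s rfl hu.symm).2 hrel⟩), ?_⟩
  suffices e : taftEnd hq _ _ = (φ : QTaft hq (ξ ^ t) →ₐc[K] QTaft hq (ξ ^ t)) from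
    DFunLike.congr_fun e
  refine bialgHom_ext fun i => ?_
  rw [taftEnd_gen]
  rcases i with _ | _ | _
  · refine Eq.trans ?_ hg.symm
    exact monomial_congr _ _ _ (by simp [hu]) (by simp)
  · exact hh.symm
  · exact hx.symm

theorem taftAut_bijective (hm : 3 ≤ m) :
    Function.Bijective (taftAut hq (by omega) : Kˣ × TaftS hq ξ t →* _) := by
  refine ⟨fun p p' e => ?_, fun φ => ?_⟩
  · refine inv_injective (taftEnd_injective hq (by omega) (BialgHom.ext fun y => ?_))
    exact DFunLike.congr_fun e y
  · obtain ⟨p, hp⟩ := exists_taftEnd_eq hq hm φ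
    exact ⟨p⁻¹, BialgEquiv.ext fun y => by rw [taftAut_apply, inv_inv, hp]⟩

end Group

end QTaft

/-- The group of Hopf algebra automorphisms of `T_{nm²}^{ξ^t}(q)` is isomorphic to
`K^* × S^t_{m,n}(q)`. -/
theorem theorem3p6 {K : Type u} [Field K] {m n : ℕ} [NeZero m] [NeZero n] (hm : 3 ≤ m) (hn : 2 ≤ n)
    {q : K} (hq : IsPrimitiveRoot q m)
    (ξ : rootsOfUnity n K) (hξ : ∀ ζ : rootsOfUnity n K, ζ ∈ Subgroup.zpowers ξ)
    (t : ℕ) (ht : t < Nat.card (rootsOfUnity n K)) :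
    Nonempty (HopfAut K (QTaft hq (ξ ^ t)) ≃* Kˣ × TaftS hq ξ t) := by
  exact ⟨(MulEquiv.ofBijective _ (QTaft.taftAut_bijective hq hm)).symm⟩
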